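/- Let $C$ be an integral domain and let $\lambda\in C$ be non-zero. A Baxter $C$-algebra of weight $\lambda$ is a commutative $C$-algebra $R$ with a $C$-linear map $P:R\to R$ such that $P(x)P(y)=P(xP(y))+P(yP(x))+\lambda P(xy)$; homomorphisms are $C$-algebra homomorphisms commuting with the operators. For a commutative $C$-algebra $A$, the shuffle Baxter algebra is $\mathrm{Sh}_C(A)=\bigoplus_{k\ge 0}A^{\otimes(k+1)}$, with operator $P_A(x_0\otimes\cdots\otimes x_n)=1\otimes x_0\otimes\cdots\otimes x_n$ and with the mixable shuffle product $$(x_0\otimes\cdots\otimes x_m)\diamond(y_0\otimes\cdots\otimes y_n)=\sum_{(\sigma,T)}\lambda^{|T|}\,x_0y_0\otimes\sigma(x_1\otimes\cdots\otimes x_m\otimes y_1\otimes\cdots\otimes y_n;T),$$ where $\sigma$ runs over the $(m,n)$-shuffles in $S_{m+n}$ (that is, $\sigma^{-1}$ is increasing on $\{1,\dots,m\}$ and on $\{m+1,\dots,m+n\}$), $T$ runs over the sets of pairs $(k,k+1)$ with $\sigma(k)\le m<\sigma(k+1)$, and $\sigma(u_1\otimes\cdots\otimes u_{m+n};T)$ is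 $u_{\sigma(1)}\otimes\cdots\otimes u_{\sigma(m+n)}$ with the factors $u_{\sigma(k)}$ and $u_{\sigma(k+1)}$ multiplied together for each $(k,k+1)\in T$. Its completion is $\widehat{\mathrm{Sh}}_C(A)=\prod_{k\ge0}A^{\otimes(k+1)}$, with the product and the operator extended by continuity. Let $\overline A=\varinjlim_{n\geq 1} A^{\otimes n}$ be the direct limit of the tensor power algebras along $x\mapsto x\otimes 1$, and let $\mathfrak A(A)=\prod_{n\ge1}\overline A$, with componentwise operations and with the operator $P'_A(a_1,a_2,a_3,\dots)=\lambda(0,a_1,a_1+a_2,\dots)$. For $a\in A$ let $t^{(a)}\in\mathfrak A(A)$ be the sequence with $k$-th component $1\otimes\cdots\otimes1\otimes a\in A^{\otimes k}$, and let $\mathfrak S(A)\subseteq\mathfrak A(A)$ be the Baxter subalgebra (the $C$-subalgebra stable under $P'_A$) generated by all $t^{(a)}$. Take $A=C$. The canonical map $C\to\overline C$ is an isomorphism, by which we identify $\overline C$ with $C$. Every element of $\mathrm{Sh}_C(C)$ can be written uniquely as $\sum_{n\ge0} b_n\mathbf 1^{\otimes(n+1)}$ with $b_n\in C$ almost all zero,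 and every element of $\widehat{\mathrm{Sh}}_C(C)$ can be written uniquely in this form with arbitrary $b_n\in C$. There is a unique homomorphism of Baxter $C$-algebras $\Phi:\mathrm{Sh}_C(C)\to\mathfrak S(C)$ with $\Phi(a)=t^{(a)}$ for all $a\in C$ (where $C$ is the first summand of $\mathrm{Sh}_C(C)$); it is an isomorphism, and $$\Phi\Big(\sum_{n\ge0} b_n\mathbf 1^{\otimes(n+1)}\Big)=\Big(\sum_{i=0}^{n-1}\binom{n-1}{i}\lambda^i b_i\Big)_{n\ge1}.$$ Moreover $\Phi$ extends uniquely to a homomorphism of Baxter algebras $\widehat\Phi:\widehat{\mathrm{Sh}}_C(C)\to\mathfrak A(C)$; it is injective, and it is given by the same formula for arbitrary sequences $(b_n)_{n\ge0}$ in $C$. -/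

import Mathlib

open scoped TensorProduct DirectSum

noncomputable section

namespace FreeBaxter

/-! ### Tensor powers -/

section TensorPower

variable (C : Type*) [CommRing C] (A : Type*) [CommRing A] [Algebra C A]

/-- The tensor power `A^{⊗ n}` over `C`; it is also regarded as a `C`-algebra with the
componentwise multiplication. -/
abbrev TPow (n : ℕ) : Type _ := ⨂[C] (_ : Fin n), A

variable {C A} in
/-- The algebra homomorphism `A^{⊗ m} → A^{⊗ n}` which puts the `i`-th factor into position `f i`.
Factors that are sent to the same position are multiplied, and positions that are not hit are
filled with `1` (see `place_tprod`). -/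
def place {m n : ℕ} (f : Fin m → Fin n) : TPow C A m →ₐ[C] TPow C A n :=
  PiTensorProduct.liftAlgHom
    ((MultilinearMap.mkPiAlgebra C (Fin m) (TPow C A n)).compLinearMap
      fun i => (PiTensorProduct.singleAlgHom (R := C) (A := fun _ : Fin n => A) (f i)).toLinearMap)
    (by simp [Pi.one_def, -PiTensorProduct.singleAlgHom_apply])
    (by
      intro x y
      simp only [MultilinearMap.compLinearMap_apply, MultilinearMap.mkPiAlgebra_apply,
        AlgHom.toLinearMap_apply, Pi.mul_apply, map_mul, Finset.prod_mul_distrib])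

theorem place_tprod {m n : ℕ} (f : Fin m → Fin n) (x : Fin m → A) :
    place f (PiTensorProduct.tprod C x) =
      PiTensorProduct.tprod C (fun j => ∏ i with f i = j, x i) := by
  have h : (fun j => ∏ i with f i = j, x i) =
      ∏ i, (Pi.mulSingle (f i) (x i) : Fin n → A) := by
    funext j
    rw [Finset.prod_apply, Finset.prod_filter]
    refine Finset.prod_congr rfl fun i _ => ?_
    by_cases hj : f i = j
    · subst hj; simp
    · rw [if_neg hj, Pi.mulSingle_eq_of_ne (fun h => hj h.symm)]
  rw [h, PiTensorProduct.tprod_prod]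
  exact (PiTensorProduct.lift.tprod x).trans rfl

end TensorPower

/-! ### Mixable shuffles -/

section Shuffles

/-- `σ ∈ S_{m+n}` is an `(m,n)`-shuffle: `σ⁻¹` is increasing on the first `m` and on the last `n`
indices. -/
def IsShuffle (m n : ℕ) (σ : Equiv.Perm (Fin (m + n))) : Prop :=
  StrictMono (fun i : Fin m => σ⁻¹ (Fin.castAdd n i)) ∧
    StrictMono (fun j : Fin n => σ⁻¹ (Fin.natAdd m j))

/-- The pair `(k, k+1)` is admissible for `σ`: `σ k` is one of the first `m` indices and `σ (k+1)`
one of the last `n`. -/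
def IsAdmissible (m n : ℕ) (σ : Equiv.Perm (Fin (m + n))) (k : Fin (m + n)) : Prop :=
  ∃ h : (k : ℕ) + 1 < m + n, (σ k : ℕ) < m ∧ m ≤ (σ ⟨k + 1, h⟩ : ℕ)

/-- A mixable `(m,n)`-shuffle `(σ, T)`; the pair `(k, k+1)` is encoded by `k`. -/
def MixableShuffle (m n : ℕ) : Type :=
  {s : Equiv.Perm (Fin (m + n)) × Finset (Fin (m + n)) //
    IsShuffle m n s.1 ∧ ∀ k ∈ s.2, IsAdmissible m n s.1 k}

namespace MixableShuffle

variable {m n : ℕ}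

instance : Finite (MixableShuffle m n) := Subtype.finite

instance : Fintype (MixableShuffle m n) := Fintype.ofFinite _

/-- The shuffle `σ`. -/
def perm (s : MixableShuffle m n) : Equiv.Perm (Fin (m + n)) := s.1.1

/-- The set `T` of merged pairs. -/
def merged (s : MixableShuffle m n) : Finset (Fin (m + n)) := s.1.2

theorem block_lt (s : MixableShuffle m n) (p : Fin (m + n)) :
    (p : ℕ) - (s.merged.filter (· < p)).card < m + n - s.merged.card := by
  have h1 : (s.merged.filter (· < p)).card ≤ p := by
    calc (s.merged.filter (· < p)).card ≤ (Finset.Iio p).card :=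
          Finset.card_le_card fun x hx => by simpa using (Finset.mem_filter.1 hx).2
      _ = p := by simp
  have hlast : ∀ k ∈ s.merged, (k : ℕ) + 1 < m + n := fun k hk => (s.2.2 k hk).1
  have h2 : (s.merged.filter (fun k => ¬ k < p)).card ≤ m + n - 1 - p := by
    rw [← Finset.card_map Fin.valEmbedding]
    calc _ ≤ (Finset.Ico (p : ℕ) (m + n - 1)).card := by
          refine Finset.card_le_card fun x hx => ?_
          simp only [Finset.mem_map, Finset.mem_filter, not_lt, Fin.valEmbedding_apply] at hx
          obtain ⟨k, ⟨hk, hpk⟩, rfl⟩ := hx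
          have := hlast k hk
          have : (p : ℕ) ≤ k := hpk
          simp only [Finset.mem_Ico]
          omega
      _ = m + n - 1 - p := by simp
  have h3 := Finset.card_filter_add_card_filter_not (s := s.merged) (fun k => k < p)
  have := p.2
  omega

/-- After the pairs in `T` have been merged, the `p`-th factor of the shuffle stands at position
`p - #{k ∈ T | k < p}` among the remaining `m + n - |T|` positions. -/
def block (s : MixableShuffle m n) (p : Fin (m + n)) : Fin (m + n - s.merged.card) :=
  ⟨p - (s.merged.filter (· < p)).card, s.block_lt p⟩

/-- The position in `x₀ y₀ ⊗ σ(x⁺ ⊗ y⁺; T)` of each factor of `x = x₀ ⊗ x₁ ⊗ ⋯ ⊗ x_m`. -/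
def slotLeft (s : MixableShuffle m n) : Fin (m + 1) → Fin (m + n - s.merged.card + 1) :=
  Fin.cases 0 fun i => (s.block (s.perm⁻¹ (Fin.castAdd n i))).succ

/-- The position in `x₀ y₀ ⊗ σ(x⁺ ⊗ y⁺; T)` of each factor of `y = y₀ ⊗ y₁ ⊗ ⋯ ⊗ y_n`. -/
def slotRight (s : MixableShuffle m n) : Fin (n + 1) → Fin (m + n - s.merged.card + 1) :=
  Fin.cases 0 fun j => (s.block (s.perm⁻¹ (Fin.natAdd m j))).succ

end MixableShuffle

end Shuffles

/-! ### Homomorphisms -/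

/-- `f : (R, P) → (S, Q)` is a homomorphism of Baxter `C`-algebras: `C`-linear, unital,
multiplicative, and compatible with the operators. -/
structure IsBaxterHom {C R S : Type*} [CommRing C] [AddCommGroup R] [Module C R] [Mul R] [One R]
    [AddCommGroup S] [Module C S] [Mul S] [One S]
    (P : R →ₗ[C] R) (Q : S →ₗ[C] S) (f : R →ₗ[C] S) : Prop where
  map_one : f 1 = 1
  map_mul : ∀ x y, f (x * y) = f x * f y
  map_op : ∀ x, f (P x) = Q (f x)

/-! ### The shuffle Baxter algebra and its completion -/

section Shuffle

variable {C : Type*} [CommRing C] (lam : C) (A : Type*) [CommRing A] [Algebra C A]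

set_option linter.unusedVariables false in
/-- The shuffle Baxter algebra `Ш_C(A) = ⨁_{k ≥ 0} A^{⊗ (k+1)}` of weight `lam`. -/
def Sha (lam : C) (A : Type*) [CommRing A] [Algebra C A] : Type _ := ⨁ k : ℕ, TPow C A (k + 1)

namespace Sha

instance : AddCommGroup (Sha lam A) := inferInstanceAs (AddCommGroup (⨁ k : ℕ, TPow C A (k + 1)))

instance : Module C (Sha lam A) := inferInstanceAs (Module C (⨁ k : ℕ, TPow C A (k + 1)))

/-- The inclusion of the summand `A^{⊗ (k+1)}`. -/
def incl (k : ℕ) : TPow C A (k + 1) →ₗ[C] Sha lam A :=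
  DirectSum.lof C ℕ (fun k => TPow C A (k + 1)) k

/-- The projection to the summand `A^{⊗ (k+1)}`. -/
def proj (k : ℕ) : Sha lam A →ₗ[C] TPow C A (k + 1) :=
  DirectSum.component C ℕ (fun k => TPow C A (k + 1)) k

/-- The embedding `j_A : A → Ш_C(A)` as the first summand. -/
def j : A →ₗ[C] Sha lam A :=
  incl lam A 0 ∘ₗ (PiTensorProduct.singleAlgHom (R := C) (A := fun _ : Fin 1 => A) 0).toLinearMap

/-- The mixable shuffle product
`x ⋄ y = ∑_{(σ,T)} lam^|T| x₀ y₀ ⊗ σ(x⁺ ⊗ y⁺; T)` of `A^{⊗ (m+1)}` and `A^{⊗ (n+1)}`. -/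
def mulHom (m n : ℕ) : TPow C A (m + 1) →ₗ[C] TPow C A (n + 1) →ₗ[C] Sha lam A :=
  ∑ s : MixableShuffle m n, lam ^ s.merged.card •
    ((LinearMap.mul C (TPow C A (m + n - s.merged.card + 1))).compl₁₂
      (place s.slotLeft).toLinearMap (place s.slotRight).toLinearMap).compr₂ (incl lam A _)

/-- The mixable shuffle product on `Ш_C(A)`. -/
def mul : Sha lam A →ₗ[C] Sha lam A →ₗ[C] Sha lam A :=
  DirectSum.toModule C ℕ _ fun m =>
    (DirectSum.toModule C ℕ _ fun n => (mulHom lam A m n).flip : Sha lam A →ₗ[C] _).flip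

instance : Mul (Sha lam A) := ⟨fun x y => mul lam A x y⟩

instance : One (Sha lam A) := ⟨j lam A 1⟩

/-- The Baxter operator `P_A (x₀ ⊗ ⋯ ⊗ x_n) = 1 ⊗ x₀ ⊗ ⋯ ⊗ x_n`. -/
def op : Sha lam A →ₗ[C] Sha lam A :=
  DirectSum.toModule C ℕ _ fun n =>
    incl lam A (n + 1) ∘ₗ (place (Fin.succ : Fin (n + 1) → Fin (n + 1 + 1))).toLinearMap

end Sha

set_option linter.unusedVariables false in
/-- The complete shuffle Baxter algebra, as the product `∏_{k ≥ 0} A^{⊗ (k+1)}`. -/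
def ShaHat (lam : C) (A : Type*) [CommRing A] [Algebra C A] : Type _ :=
  (k : ℕ) → TPow C A (k + 1)

namespace ShaHat

instance : AddCommGroup (ShaHat lam A) := inferInstanceAs (AddCommGroup ((k : ℕ) → TPow C A (k + 1)))

instance : Module C (ShaHat lam A) := inferInstanceAs (Module C ((k : ℕ) → TPow C A (k + 1)))

/-- The inclusion `Ш_C(A) → ∏_k A^{⊗ (k+1)}`. -/
def ofSha : Sha lam A →ₗ[C] ShaHat lam A :=
  LinearMap.pi fun k => Sha.proj lam A k

/-- The truncation of a series to its components of degree `≤ k`. -/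
def trunc (k : ℕ) (x : ShaHat lam A) : Sha lam A :=
  ∑ i ∈ Finset.range (k + 1), Sha.incl lam A i (x i)

/-- The continuous extension of the product of `Ш_C(A)`: since the elements without components of
degree `≤ k` form an ideal of `Ш_C(A)`, the component of degree `k` of a product only depends on
the components of degree `≤ k` of the factors. -/
instance : Mul (ShaHat lam A) :=
  ⟨fun x y k => Sha.proj lam A k (trunc lam A k x * trunc lam A k y)⟩

instance : One (ShaHat lam A) := ⟨ofSha lam A 1⟩

/-- The continuous extension of the Baxter operator. -/
def op : ShaHat lam A →ₗ[C] ShaHat lam A :=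
  LinearMap.pi fun k => match k with
    | 0 => 0
    | k + 1 => (place (Fin.succ : Fin (k + 1) → Fin (k + 1 + 1))).toLinearMap ∘ₗ
        (LinearMap.proj k : ((k : ℕ) → TPow C A (k + 1)) →ₗ[C] TPow C A (k + 1))

end ShaHat

end Shuffle

/-! ### The standard Baxter algebra -/

section Standard

variable (C : Type*) [CommRing C] (A : Type*) [CommRing A] [Algebra C A]

/-- The direct limit `Ā` of the algebras `A^{⊗ n}`, `n ≥ 1`, along `x ↦ x ⊗ 1 ⊗ ⋯ ⊗ 1`. -/
def Bar : Type _ :=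
  Ring.DirectLimit (ι := ℕ+) (fun n => TPow C A n)
    (fun m n (h : m ≤ n) => (place (Fin.castLE h) : TPow C A m → TPow C A n))

instance : CommRing (Bar C A) :=
  Ring.instCommRingDirectLimit _ _

/-- The canonical map `A^{⊗ n} → Ā`. -/
def Bar.of (n : ℕ+) : TPow C A n →+* Bar C A :=
  Ring.DirectLimit.of (ι := ℕ+) (fun n => TPow C A n)
    (fun m n (h : m ≤ n) => (place (Fin.castLE h) : TPow C A m → TPow C A n)) n

instance : Algebra C (Bar C A) :=
  ((Bar.of C A 1).comp (algebraMap C (TPow C A ((1 : ℕ+) : ℕ)))).toAlgebra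

/-- The algebra `𝔄(A) = ∏_{n ≥ 1} Ā` of sequences, with the componentwise operations. -/
abbrev StdSeq : Type _ := ℕ+ → Bar C A

variable {C}

/-- The operator `P'_A (a₁, a₂, a₃, …) = lam (0, a₁, a₁ + a₂, …)` on `𝔄(A)`. -/
def stdOp (lam : C) : StdSeq C A →ₗ[C] StdSeq C A :=
  lam • LinearMap.pi fun n => ∑ i ∈ Finset.Iio n, LinearMap.proj i

variable (C) {A} in
/-- The sequence `t^{(a)}`, with `k`-th component `1 ⊗ ⋯ ⊗ 1 ⊗ a ∈ A^{⊗ k}`. -/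
def tSeq (a : A) : StdSeq C A := fun k =>
  Bar.of C A k (PiTensorProduct.tprod C fun i : Fin k => if (i : ℕ) + 1 = k then a else 1)

/-- The standard Baxter algebra `𝔖(A)`: the Baxter subalgebra of `𝔄(A)` generated by the
sequences `t^{(a)}`. -/
def Std (lam : C) : Subalgebra C (StdSeq C A) :=
  sInf {S | (∀ a : A, tSeq C a ∈ S) ∧ ∀ x ∈ S, stdOp A lam x ∈ S}

theorem stdOp_mem (lam : C) : ∀ x ∈ (Std A lam).toSubmodule, stdOp A lam x ∈ (Std A lam).toSubmodule :=
  fun x hx => Algebra.mem_sInf.2 fun S hS => hS.2 x (Algebra.mem_sInf.1 hx S hS)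

theorem tSeq_mem (lam : C) (a : A) : tSeq C a ∈ Std A lam :=
  Algebra.mem_sInf.2 fun _ hS => hS.1 a

/-- The Baxter operator of `𝔖(A)`. -/
def Std.op (lam : C) : Std A lam →ₗ[C] Std A lam :=
  LinearMap.restrict (p := (Std A lam).toSubmodule) (q := (Std A lam).toSubmodule)
    (stdOp A lam) (stdOp_mem A lam)

end Standard

/-! ### The case `A = C` -/

section Base

variable {C : Type*} [CommRing C] (lam : C)

/-- The element `∑_n b_n 1^{⊗ (n+1)}` of `Ш_C(C)`, for `b` of finite support. -/
def shaSum (b : ℕ →₀ C) : Sha lam C :=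
  b.sum fun n c => c • Sha.incl lam C n (PiTensorProduct.tprod C fun _ => 1)

/-- The element `∑_n b_n 1^{⊗ (n+1)}` of the completion, for an arbitrary sequence `b`. -/
def shaHatSum (b : ℕ → C) : ShaHat lam C :=
  fun n => b n • PiTensorProduct.tprod C fun _ => 1

/-- The sequence in `𝔄(C)` with `n`-th component `∑_{i=0}^{n-1} binom(n-1, i) lam^i b_i`, read in
`C̄` through the canonical map `C → C̄`. -/
def binomSeq (b : ℕ → C) : StdSeq C C := fun n =>
  algebraMap C (Bar C C)
    (∑ i ∈ Finset.range n, (((n : ℕ) - 1).choose i : C) * lam ^ i * b i)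

end Base

end FreeBaxter

end

noncomputable section

namespace FreeBaxter

/-! Each tensor power of `C` is free of rank one on its unit, so $\mathrm{Sh}_C(C)$ has basis
$\mathbf 1^{\otimes(n+1)}=P^n(1)$ and the transition maps of the direct limit are identities in
coordinates. A Baxter homomorphism is therefore forced on the basis: by Pascal's rule, iterating
$P'$ on $1$ gives $P'^m(1)=\big(\lambda^m\binom{N-1}{m}\big)_{N\ge1}$ (`stdOp_binomSeq`).

Multiplicativity on the basis is the identity $\sum_{(\sigma,T)}\binom N{m+n-|T|}=\binom Nm\binom
Nn$ (`MixableShuffle.sum_choose`). Both sides count pairs of an $m$-subset and an $n$-subset of an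
$N$-set: the union has $m+n-|T|$ elements, and the mixable shuffle records which of them, in order,
lie in the first set, the second or both. The proof encodes $(\sigma,T)$ by finite sets and uses a
Delannoy-type recursion (`shuffleSum_succ`).

The binomial transform is triangular with diagonal entries $\lambda^p\neq0$, hence injective
(`binomSeq_injective`). Its $n$-th component involves only degrees below $n$, so the formula and
multiplicativity pass to the completion, where `hatHom` is defined; $\Phi$ is its restriction, with
image $\mathfrak S(C)$ (`range_hatHom_comp_ofSha`). The extension is unique because every series is
a constant plus some $P(y)$, while $P'$ looks only at strictly earlier components
(`eq_of_comp_ofSha_eq`). -/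

/-! ### Counting mixable shuffles -/

/-- The elements of `S` whose successor lies in `range L` but not in `S`. -/
def ascents (L : ℕ) (S : Finset ℕ) : Finset ℕ := S.filter fun k => k + 1 < L ∧ k + 1 ∉ S

theorem mem_ascents {L : ℕ} {S : Finset ℕ} {k : ℕ} :
    k ∈ ascents L S ↔ k ∈ S ∧ k + 1 < L ∧ k + 1 ∉ S := Finset.mem_filter

/-- `S` marks the positions of left factors in a word. Appending a left factor creates no left-right
adjacency. -/
theorem ascents_insert_self (L : ℕ) (S : Finset ℕ) :
    ascents (L + 1) (insert L S) = ascents L S := by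
  ext k
  simp only [mem_ascents, Finset.mem_insert]
  constructor
  · rintro ⟨h1, h2, h3⟩
    refine ⟨h1.resolve_left (by omega), ?_, fun h => h3 (Or.inr h)⟩
    have : k + 1 ≠ L := fun h => h3 (Or.inl h)
    omega
  · rintro ⟨h1, h2, h3⟩
    exact ⟨Or.inr h1, by omega, by rintro (h | h); exacts [by omega, h3 h]⟩

/-- A right factor appended after a left one at position `L` creates exactly one new admissible
pair. -/
theorem ascents_succ_insert {L : ℕ} {S : Finset ℕ} (hS : S ⊆ Finset.range L) :
    ascents (L + 2) (insert L S) = insert L (ascents (L + 1) (insert L S)) := by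
  have hL : L + 1 ∉ S := fun h => by have := Finset.mem_range.1 (hS h); omega
  ext k
  simp only [mem_ascents, Finset.mem_insert]
  constructor
  · rintro ⟨h1, h2, h3⟩
    by_cases h : k = L
    · exact Or.inl h
    · exact Or.inr ⟨h1, by omega, h3⟩
  · rintro (rfl | ⟨h1, h2, h3⟩)
    · exact ⟨Or.inl rfl, by omega, by rintro (h | h); exacts [by omega, hL h]⟩
    · exact ⟨h1, by omega, h3⟩

theorem ascents_succ_of_subset {L : ℕ} {S : Finset ℕ} (hS : S ⊆ Finset.range L) :
    ascents (L + 2) S = ascents (L + 1) S := by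
  ext k
  simp only [mem_ascents]
  refine ⟨fun ⟨h1, h2, h3⟩ => ⟨h1, ?_, h3⟩, fun ⟨h1, h2, h3⟩ => ⟨h1, by omega, h3⟩⟩
  have := Finset.mem_range.1 (hS h1)
  omega

theorem card_le_of_subset_ascents {L : ℕ} {S T : Finset ℕ} (hT : T ∈ (ascents L S).powerset) :
    T.card ≤ L := by
  rw [← Finset.card_range L]
  refine Finset.card_le_card fun k hk => ?_
  have := mem_ascents.1 (Finset.mem_powerset.1 hT hk)
  simp only [Finset.mem_range]
  omega

/-- The sum of `f (L - |T|)` over the `m`-element subsets `S` of `range L` and the subsets `T` of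
`ascents L S`. -/
def shuffleSum (L m : ℕ) (f : ℕ → ℕ) : ℕ :=
  ∑ S ∈ (Finset.range L).powersetCard m, ∑ T ∈ (ascents L S).powerset, f (L - T.card)

theorem sum_powersetCard_range_succ (L m : ℕ) (g : Finset ℕ → ℕ) :
    ∑ S ∈ (Finset.range (L + 1)).powersetCard (m + 1), g S =
      ∑ S ∈ (Finset.range L).powersetCard (m + 1), g S +
        ∑ S ∈ (Finset.range L).powersetCard m, g (insert L S) := by
  have hmem : ∀ {k S}, S ∈ (Finset.range L).powersetCard k → L ∉ S := fun hS h => by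
    simpa using (Finset.mem_powersetCard.1 hS).1 h
  rw [Finset.range_add_one, Finset.powersetCard_succ_insert Finset.notMem_range_self,
    Finset.sum_union, Finset.sum_image]
  · intro S hS S' hS' h
    rw [← Finset.erase_insert (hmem hS), ← Finset.erase_insert (hmem hS'), h]
  · refine Finset.disjoint_left.2 fun S hS hS' => ?_
    obtain ⟨S', -, rfl⟩ := Finset.mem_image.1 hS'
    exact hmem hS (Finset.mem_insert_self _ _)

theorem sum_ascents_shift {L L' : ℕ} {S S' : Finset ℕ} (f : ℕ → ℕ) (h : ascents L' S' = ascents L S)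
    (hL : L' = L + 1) :
    ∑ T ∈ (ascents L' S').powerset, f (L' - T.card) =
      ∑ T ∈ (ascents L S).powerset, f (L - T.card + 1) := by
  subst hL
  rw [h]
  refine Finset.sum_congr rfl fun T hT => ?_
  rw [Nat.sub_add_comm (card_le_of_subset_ascents hT)]

theorem shuffleSum_zero (L : ℕ) (f : ℕ → ℕ) : shuffleSum L 0 f = f L := by
  simp [shuffleSum, ascents]

theorem shuffleSum_self (L : ℕ) (f : ℕ → ℕ) : shuffleSum L L f = f L := by
  have h : ascents L (Finset.range L) = ∅ := by
    ext k
    simp only [mem_ascents, Finset.mem_range, Finset.notMem_empty]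
    exact ⟨fun h => absurd h.2.1 h.2.2, False.elim⟩
  have := Finset.powersetCard_self (Finset.range L)
  rw [Finset.card_range] at this
  simp [shuffleSum, this, h]

/-- The three terms are the possible ends of a merged word: a left factor, an unmerged right factor,
or a right factor merged with the left factor before it. -/
theorem shuffleSum_succ (L m : ℕ) (f : ℕ → ℕ) :
    shuffleSum (L + 2) (m + 1) f =
      shuffleSum (L + 1) m (fun i => f (i + 1)) + shuffleSum (L + 1) (m + 1) (fun i => f (i + 1)) +
        shuffleSum L m (fun i => f (i + 1)) := by
  have h1 : ∑ S ∈ (Finset.range (L + 1)).powersetCard m,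
      ∑ T ∈ (ascents (L + 1 + 1) (insert (L + 1) S)).powerset, f (L + 1 + 1 - T.card) =
      shuffleSum (L + 1) m (fun i => f (i + 1)) :=
    Finset.sum_congr rfl fun S _ =>
      sum_ascents_shift f (ascents_insert_self _ _) rfl
  have h2 : ∑ S ∈ (Finset.range (L + 1)).powersetCard (m + 1),
      ∑ T ∈ (ascents (L + 1 + 1) S).powerset, f (L + 1 + 1 - T.card) =
      shuffleSum (L + 1) (m + 1) (fun i => f (i + 1)) + shuffleSum L m (fun i => f (i + 1)) := by
    -- The word ends in a right factor. A second split, on whether position `L` is a left factor,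
    -- isolates the case where merging with it is possible.
    rw [shuffleSum, sum_powersetCard_range_succ, sum_powersetCard_range_succ,
      add_assoc (Finset.sum _ _), shuffleSum,
      ← Finset.sum_add_distrib]
    refine congr_arg₂ _ (Finset.sum_congr rfl fun S hS => ?_) (Finset.sum_congr rfl fun S hS => ?_)
    · exact sum_ascents_shift f (ascents_succ_of_subset (Finset.mem_powersetCard.1 hS).1) rfl
    · have hsub := (Finset.mem_powersetCard.1 hS).1
      have hL : L ∉ ascents (L + 1) (insert L S) := by simp [mem_ascents]
      rw [ascents_succ_insert hsub, Finset.sum_powerset_insert hL, ascents_insert_self]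
      refine congr_arg₂ _ (Finset.sum_congr rfl fun T hT => ?_) (Finset.sum_congr rfl fun T hT => ?_)
      · have := card_le_of_subset_ascents hT
        congr 1; omega
      · have := card_le_of_subset_ascents hT
        rw [ascents_insert_self] at hL
        rw [Finset.card_insert_of_notMem fun h => hL (Finset.mem_powerset.1 hT h)]
        congr 1; omega
  rw [shuffleSum, sum_powersetCard_range_succ, h1, h2]
  ring

theorem shuffleSum_add (L m : ℕ) (f g : ℕ → ℕ) :
    shuffleSum L m (fun i => f i + g i) = shuffleSum L m f + shuffleSum L m g := by
  simp only [shuffleSum, Finset.sum_add_distrib]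

/-- Pascal's rule splits $\binom{N+1}{i+1}$ in the recursion. The $\binom Ni$ parts give three of
the four products in $\big(\binom Nm+\binom N{m+1}\big)\big(\binom Nn+\binom N{n+1}\big)$; the
$\binom N{i+1}$ parts reassemble, by the same recursion at `N`, into the fourth. -/
theorem shuffleSum_choose (N m n : ℕ) :
    shuffleSum (m + n) m (fun i => N.choose i) = N.choose m * N.choose n := by
  induction N generalizing m n with
  | zero =>
    rcases m with _ | m
    · simp [shuffleSum_zero]
    rcases n with _ | n
    · simp [shuffleSum_self]
    · rw [show m + 1 + (n + 1) = m + n + 2 by ring, shuffleSum_succ]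
      simp [shuffleSum]
  | succ N ih =>
    rcases m with _ | m
    · simp [shuffleSum_zero]
    rcases n with _ | n
    · simp [shuffleSum_self]
    · have h1 := ih m n
      have h2 := ih (m + 1) n
      have h3 := ih m (n + 1)
      have h4 := ih (m + 1) (n + 1)
      rw [show m + 1 + n = m + n + 1 by ring] at h2
      rw [show m + (n + 1) = m + n + 1 by ring] at h3
      rw [show m + 1 + (n + 1) = m + n + 2 by ring, shuffleSum_succ] at h4
      rw [show m + 1 + (n + 1) = m + n + 2 by ring, shuffleSum_succ]
      simp only [Nat.choose_succ_succ', shuffleSum_add, h1, h2, h3]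
      linear_combination h4

/-! ### Mixable shuffles as pairs of a set of left positions and a set of its ascents -/

namespace MixableShuffle

variable {m n : ℕ}

/-- The positions of the first `m` factors. -/
def leftSet (s : MixableShuffle m n) : Finset ℕ :=
  (Finset.univ.filter fun k => (s.perm k : ℕ) < m).map Fin.valEmbedding

theorem mem_leftSet (s : MixableShuffle m n) (k : Fin (m + n)) :
    (k : ℕ) ∈ s.leftSet ↔ (s.perm k : ℕ) < m := by
  simp [leftSet, Fin.val_inj]

theorem leftSet_eq_map (s : MixableShuffle m n) :
    s.leftSet = (Finset.univ : Finset (Fin m)).image fun i => (s.perm⁻¹ (Fin.castAdd n i) : ℕ) := by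
  ext k
  simp only [leftSet, Finset.mem_map, Finset.mem_filter, Finset.mem_univ, true_and,
    Fin.valEmbedding_apply, Finset.mem_image]
  constructor
  · rintro ⟨k, hk, rfl⟩
    exact ⟨⟨s.perm k, hk⟩, by simp [Equiv.Perm.inv_def]⟩
  · rintro ⟨i, rfl⟩
    exact ⟨_, by simp, rfl⟩

theorem leftSet_mem (s : MixableShuffle m n) :
    s.leftSet ∈ (Finset.range (m + n)).powersetCard m := by
  refine Finset.mem_powersetCard.2 ⟨fun k hk => ?_, ?_⟩
  · simp only [leftSet, Finset.mem_map] at hk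
    obtain ⟨k, -, rfl⟩ := hk
    simp
  · rw [leftSet_eq_map]
    refine (Finset.card_image_of_injective _ (Fin.val_injective.comp s.2.1.1.injective)).trans ?_
    rw [Finset.card_univ, Fintype.card_fin]

theorem map_merged_subset (s : MixableShuffle m n) :
    s.merged.map Fin.valEmbedding ⊆ ascents (m + n) s.leftSet := by
  intro k hk
  obtain ⟨k, hk', rfl⟩ := Finset.mem_map.1 hk
  obtain ⟨h, h1, h2⟩ := s.2.2 k hk'
  refine mem_ascents.2 ⟨(mem_leftSet s k).2 h1, h, fun h3 => ?_⟩
  exact absurd ((mem_leftSet s ⟨k + 1, h⟩).1 h3) (not_lt.2 h2)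

theorem card_merged_le_left (s : MixableShuffle m n) : s.merged.card ≤ m := by
  refine le_of_le_of_eq ?_ (Finset.mem_powersetCard.1 s.leftSet_mem).2
  rw [← Finset.card_map Fin.valEmbedding]
  exact Finset.card_le_card (s.map_merged_subset.trans (Finset.filter_subset _ _))

/-- The successors of the merged positions are distinct positions of right factors. -/
theorem card_merged_le_right (s : MixableShuffle m n) : s.merged.card ≤ n := by
  have hs := Finset.mem_powersetCard.1 s.leftSet_mem
  have h : (Finset.range (m + n) \ s.leftSet).card = n := by
    rw [Finset.card_sdiff_of_subset hs.1, hs.2, Finset.card_range]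
    omega
  refine le_of_le_of_eq ?_ h
  rw [← Finset.card_map Fin.valEmbedding,
    ← Finset.card_image_of_injective _ (add_left_injective 1)]
  refine Finset.card_le_card fun k hk => ?_
  obtain ⟨k, hk', rfl⟩ := Finset.mem_image.1 hk
  have := mem_ascents.1 (s.map_merged_subset hk')
  simpa using this.2

/-- A strictly increasing map on `Fin m` or `Fin n` is determined by its range, and `σ⁻¹` maps the
two blocks onto the left positions and their complement. -/
theorem ext_of_leftSet {s t : MixableShuffle m n} (h : s.leftSet = t.leftSet)
    (h' : s.merged = t.merged) : s = t := by
  have hset : ∀ k, (s.perm k : ℕ) < m ↔ (t.perm k : ℕ) < m := fun k => by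
    rw [← mem_leftSet, ← mem_leftSet, h]
  have hl : (fun i : Fin m => s.perm⁻¹ (Fin.castAdd n i)) =
      fun i : Fin m => t.perm⁻¹ (Fin.castAdd n i) := by
    refine (StrictMono.range_inj s.2.1.1 t.2.1.1).1 ?_
    have : ∀ u : MixableShuffle m n, Set.range (fun i : Fin m => u.1.1⁻¹ (Fin.castAdd n i)) =
        {k | (u.perm k : ℕ) < m} := fun u => by
      ext k
      simp only [Set.mem_range, Set.mem_ofPred_eq]
      constructor
      · rintro ⟨i, rfl⟩
        simp [perm]
      · exact fun hk => ⟨⟨u.perm k, hk⟩, by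
          simp [Equiv.Perm.inv_def, perm]⟩
    rw [this, this]
    exact Set.ext hset
  have hr : (fun j : Fin n => s.perm⁻¹ (Fin.natAdd m j)) =
      fun j : Fin n => t.perm⁻¹ (Fin.natAdd m j) := by
    refine (StrictMono.range_inj s.2.1.2 t.2.1.2).1 ?_
    have : ∀ u : MixableShuffle m n, Set.range (fun j : Fin n => u.1.1⁻¹ (Fin.natAdd m j)) =
        {k | ¬ (u.perm k : ℕ) < m} := fun u => by
      ext k
      simp only [Set.mem_range, Set.mem_ofPred_eq]
      constructor
      · rintro ⟨i, rfl⟩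
        simp [perm]
      · exact fun hk => ⟨⟨u.perm k - m, by omega⟩, by
          simp [Equiv.Perm.inv_def, Equiv.symm_apply_eq, Fin.ext_iff, perm] at hk ⊢; omega⟩
    rw [this, this]
    exact Set.ext fun k => not_congr (hset k)
  refine Subtype.ext (Prod.ext (inv_injective (Equiv.ext fun k => ?_)) h')
  refine Fin.addCases (fun i => ?_) (fun j => ?_) k
  · exact congr_fun hl i
  · exact congr_fun hr j

theorem exists_of_leftSet {S T : Finset ℕ} (hS : S ∈ (Finset.range (m + n)).powersetCard m)
    (hT : T ⊆ ascents (m + n) S) :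
    ∃ s : MixableShuffle m n, s.leftSet = S ∧ s.merged.map Fin.valEmbedding = T := by
  obtain ⟨hsub, hcard⟩ := Finset.mem_powersetCard.1 hS
  obtain ⟨S', rfl⟩ : ∃ S' : Finset (Fin (m + n)), S'.map Fin.valEmbedding = S :=
    ⟨S.attachFin fun k hk => Finset.mem_range.1 (hsub hk), Finset.map_valEmbedding_attachFin _⟩
  have hTlt : ∀ k ∈ T, k < m + n := fun k hk =>
    (Nat.lt_succ_self k).trans (mem_ascents.1 (hT hk)).2.1
  obtain ⟨T', rfl⟩ : ∃ T' : Finset (Fin (m + n)), T'.map Fin.valEmbedding = T :=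
    ⟨T.attachFin hTlt, Finset.map_valEmbedding_attachFin _⟩
  have hm : S'.card = m := by rwa [Finset.card_map] at hcard
  have hn : S'ᶜ.card = n := by rw [Finset.card_compl, hm, Fintype.card_fin]; omega
  -- `e` plays the role of `σ⁻¹`: it enumerates `S'` increasingly, then its complement.
  let e : Equiv.Perm (Fin (m + n)) := finSumFinEquiv.symm.trans (finSumEquivOfFinset hm hn)
  have hel : ∀ i : Fin m, e (Fin.castAdd n i) = S'.orderEmbOfFin hm i := fun i => by simp [e]
  have her : ∀ j : Fin n, e (Fin.natAdd m j) = S'ᶜ.orderEmbOfFin hn j := fun j => by simp [e]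
  have hmem : ∀ k, ((e⁻¹ k : Fin (m + n)) : ℕ) < m ↔ k ∈ S' := fun k => by
    obtain ⟨l, rfl⟩ := e.surjective k
    rw [Equiv.Perm.inv_def, Equiv.symm_apply_apply]
    refine Fin.addCases (fun i => ?_) (fun j => ?_) l
    · simp [hel]
    · have := Finset.orderEmbOfFin_mem S'ᶜ hn j
      rw [Finset.mem_compl] at this
      simp [her, this]
  refine ⟨⟨(e⁻¹, T'), ⟨?_, ?_⟩, fun k hk => ?_⟩, ?_, rfl⟩
  · simpa [hel] using (S'.orderEmbOfFin hm).strictMono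
  · simpa [her] using (S'ᶜ.orderEmbOfFin hn).strictMono
  · obtain ⟨h1, h2, h3⟩ := mem_ascents.1 (hT (Finset.mem_map_of_mem _ hk))
    refine ⟨h2, (hmem k).2 (by simpa [Fin.val_inj] using h1), ?_⟩
    refine not_lt.1 fun h => h3 ?_
    exact Finset.mem_map_of_mem Fin.valEmbedding ((hmem _).1 h)
  · simp only [leftSet, perm, hmem]
    simp

theorem sum_eq_shuffleSum (f : ℕ → ℕ) :
    ∑ s : MixableShuffle m n, f (m + n - s.merged.card) = shuffleSum (m + n) m f := by
  rw [shuffleSum, Finset.sum_sigma']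
  refine Finset.sum_bij (fun s _ => ⟨s.leftSet, s.merged.map Fin.valEmbedding⟩) (fun s _ => ?_)
    (fun s _ t _ h => ?_) (fun p hp => ?_) (fun s _ => by simp)
  · exact Finset.mem_sigma.2 ⟨s.leftSet_mem, Finset.mem_powerset.2 s.map_merged_subset⟩
  · simp only [Sigma.mk.injEq, heq_eq_eq] at h
    exact ext_of_leftSet h.1 (Finset.map_injective _ h.2)
  · obtain ⟨S, T⟩ := p
    obtain ⟨hS, hT⟩ := Finset.mem_sigma.1 hp
    obtain ⟨s, h1, h2⟩ := exists_of_leftSet hS (Finset.mem_powerset.1 hT)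
    exact ⟨s, Finset.mem_univ _, by simp [h1, h2]⟩

theorem sum_choose (N : ℕ) :
    ∑ s : MixableShuffle m n, N.choose (m + n - s.merged.card) = N.choose m * N.choose n := by
  rw [sum_eq_shuffleSum, shuffleSum_choose]

end MixableShuffle

/-! ### The graded pieces of a product -/

section Graded

variable {C : Type*} [CommRing C] (lam : C) (A : Type*) [CommRing A] [Algebra C A]

namespace Sha

theorem toModule_incl {N : Type*} [AddCommGroup N] [Module C N]
    (φ : ∀ k, TPow C A (k + 1) →ₗ[C] N) (k : ℕ) (a : TPow C A (k + 1)) :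
    DirectSum.toModule C ℕ N φ (incl lam A k a) = φ k a :=
  DirectSum.toModule_lof C (M := fun k => TPow C A (k + 1)) k a

theorem proj_incl_self (k : ℕ) (a : TPow C A (k + 1)) : proj lam A k (incl lam A k a) = a :=
  DirectSum.component.lof_self C (M := fun k => TPow C A (k + 1)) k a

theorem proj_incl_of_ne {k l : ℕ} (h : k ≠ l) (a : TPow C A (k + 1)) :
    proj lam A l (incl lam A k a) = 0 :=
  DFinsupp.single_eq_of_ne h.symm

theorem mul_incl_incl {m n : ℕ} (a : TPow C A (m + 1)) (b : TPow C A (n + 1)) :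
    incl lam A m a * incl lam A n b = mulHom lam A m n a b :=
  (LinearMap.congr_fun (toModule_incl lam A _ m a) _).trans
    (LinearMap.congr_fun (toModule_incl lam A (fun n => (mulHom lam A m n).flip) n b) a)

theorem op_incl {n : ℕ} (a : TPow C A (n + 1)) :
    op lam A (incl lam A n a) = incl lam A (n + 1) (place Fin.succ a) :=
  toModule_incl lam A _ n a

variable {lam A} in
theorem hom_ext {N : Type*} [AddCommGroup N] [Module C N] {f g : Sha lam A →ₗ[C] N}
    (h : ∀ k a, f (incl lam A k a) = g (incl lam A k a)) : f = g :=
  DirectSum.linearMap_ext C fun k => LinearMap.ext fun a => h k a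

theorem mulHom_apply {m n : ℕ} (a : TPow C A (m + 1)) (b : TPow C A (n + 1)) :
    mulHom lam A m n a b = ∑ s : MixableShuffle m n, lam ^ s.merged.card •
      incl lam A (m + n - s.merged.card) (place s.slotLeft a * place s.slotRight b) := by
  simp [mulHom, LinearMap.sum_apply]

/-- Since `|T| ≤ min m n`, every term has degree `m + n - |T| ≥ max m n`. This is the continuity
behind the product on the completion. -/
theorem proj_mulHom_eq_zero {m n k : ℕ} (h : k < m ∨ k < n) (a : TPow C A (m + 1))
    (b : TPow C A (n + 1)) : proj lam A k (mulHom lam A m n a b) = 0 := by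
  rw [mulHom_apply, map_sum]
  refine Finset.sum_eq_zero fun s _ => ?_
  have h1 := s.card_merged_le_left
  have h2 := s.card_merged_le_right
  rw [map_smul, proj_incl_of_ne lam A (by omega), smul_zero]

theorem proj_incl_mul_eq_zero {m k : ℕ} (h : k < m) (a : TPow C A (m + 1)) (y : Sha lam A) :
    proj lam A k (incl lam A m a * y) = 0 := by
  refine LinearMap.congr_fun (f := proj lam A k ∘ₗ mul lam A (incl lam A m a)) (g := 0)
    (hom_ext fun n b => ?_) y
  exact (congr_arg _ (mul_incl_incl lam A a b)).trans (proj_mulHom_eq_zero lam A (Or.inl h) a b)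

theorem proj_mul_incl_eq_zero {n k : ℕ} (h : k < n) (b : TPow C A (n + 1)) (x : Sha lam A) :
    proj lam A k (x * incl lam A n b) = 0 := by
  refine LinearMap.congr_fun (f := proj lam A k ∘ₗ (mul lam A).flip (incl lam A n b)) (g := 0)
    (hom_ext fun m a => ?_) x
  exact (congr_arg _ (mul_incl_incl lam A a b)).trans (proj_mulHom_eq_zero lam A (Or.inr h) a b)

theorem add_mul (x x' y : Sha lam A) : (x + x') * y = x * y + x' * y :=
  LinearMap.map_add₂ (mul lam A) x x' y

theorem mul_add (x y y' : Sha lam A) : x * (y + y') = x * y + x * y' :=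
  map_add (mul lam A x) y y'

end Sha

namespace ShaHat

theorem trunc_succ (k : ℕ) (x : ShaHat lam A) :
    trunc lam A (k + 1) x = trunc lam A k x + Sha.incl lam A (k + 1) (x (k + 1)) :=
  Finset.sum_range_succ _ _

theorem ofSha_trunc {i k : ℕ} (h : i ≤ k) (x : ShaHat lam A) :
    ofSha lam A (trunc lam A k x) i = x i := by
  change Sha.proj lam A i (∑ j ∈ Finset.range (k + 1), Sha.incl lam A j (x j)) = x i
  refine (map_sum _ _ _).trans ((Finset.sum_eq_single_of_mem i (Finset.mem_range.2 (by omega))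
    fun j _ hj => Sha.proj_incl_of_ne lam A hj _).trans (Sha.proj_incl_self lam A i _))

/-- The product is defined by truncating at the degree read off; this allows one common truncation
for all degrees up to `k`. -/
theorem mul_apply {i k : ℕ} (h : i ≤ k) (x y : ShaHat lam A) :
    (x * y) i = ofSha lam A (trunc lam A k x * trunc lam A k y) i := by
  change Sha.proj lam A i (trunc lam A i x * trunc lam A i y) =
    Sha.proj lam A i (trunc lam A k x * trunc lam A k y)
  induction k, h using Nat.le_induction with
  | base => rfl
  | succ k hk ih =>
    rw [ih, trunc_succ, trunc_succ, Sha.add_mul, Sha.mul_add, map_add, map_add,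
      Sha.proj_incl_mul_eq_zero lam A (by omega), Sha.proj_mul_incl_eq_zero lam A (by omega),
      add_zero, add_zero]

theorem ofSha_apply (x : Sha lam A) (k : ℕ) : ofSha lam A x k = Sha.proj lam A k x := rfl

theorem op_apply_zero (x : ShaHat lam A) : op lam A x 0 = 0 := rfl

theorem op_apply_succ (x : ShaHat lam A) (k : ℕ) :
    op lam A x (k + 1) = place Fin.succ (x k) := rfl

theorem op_ofSha (x : Sha lam A) : op lam A (ofSha lam A x) = ofSha lam A (Sha.op lam A x) := by
  refine LinearMap.congr_fun (f := op lam A ∘ₗ ofSha lam A) (g := ofSha lam A ∘ₗ Sha.op lam A)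
    (Sha.hom_ext fun k a => ?_) x
  rw [LinearMap.comp_apply, LinearMap.comp_apply, Sha.op_incl]
  funext l
  rcases l with _ | l
  · rw [op_apply_zero, ofSha_apply, Sha.proj_incl_of_ne lam A (Nat.succ_ne_zero k)]
  · rw [op_apply_succ, ofSha_apply, ofSha_apply]
    by_cases hl : k = l
    · subst hl
      rw [Sha.proj_incl_self, Sha.proj_incl_self]
    · rw [Sha.proj_incl_of_ne lam A hl, Sha.proj_incl_of_ne lam A fun h => hl (Nat.succ.inj h),
        map_zero]

theorem ofSha_injective : Function.Injective (ofSha lam A) := fun _ _ h =>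
  DirectSum.ext_component C fun k => congr_fun h k

end ShaHat

end Graded

/-! ### The direct limit for `A = C` -/

section Base

variable {C : Type*} [CommRing C] (lam : C)

/-- The canonical isomorphism `C^{⊗ n} ≃ C`. -/
def coord (n : ℕ) : TPow C C n ≃ₐ[C] C := PiTensorProduct.constantBaseRingEquiv (Fin n) C

theorem eq_coord_smul {n : ℕ} (x : TPow C C n) : x = coord n x • (1 : TPow C C n) :=
  (coord n).injective (by simp)

/-- An algebra map preserves `1`, which spans each tensor power, so every `place` is the identity in
coordinates. -/
theorem coord_algHom {m n : ℕ} (f : TPow C C m →ₐ[C] TPow C C n) (x : TPow C C m) :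
    coord n (f x) = coord m x := by
  conv_lhs => rw [eq_coord_smul x]
  simp

theorem tprod_one (n : ℕ) : (PiTensorProduct.tprod C fun _ : Fin n => (1 : C)) = 1 := rfl

theorem Bar.of_place {m n : ℕ+} (h : m ≤ n) (x : TPow C C m) :
    Bar.of C C n (place (Fin.castLE h) x) = Bar.of C C m x :=
  Ring.DirectLimit.of_f _ _

theorem Bar.of_algebraMap (n : ℕ+) (c : C) :
    Bar.of C C n (algebraMap C (TPow C C n) c) = algebraMap C (Bar C C) c := by
  have h := Bar.of_place (one_le (a := n)) (algebraMap C (TPow C C ((1 : ℕ+) : ℕ)) c)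
  exact (congr_arg _ (AlgHom.commutes _ c).symm).trans h

theorem Bar.of_eq_algebraMap (n : ℕ+) (x : TPow C C n) :
    Bar.of C C n x = algebraMap C (Bar C C) (coord n x) := by
  rw [← Bar.of_algebraMap n, Algebra.algebraMap_eq_smul_one, ← eq_coord_smul]

theorem algebraMap_bar_bijective : Function.Bijective (algebraMap C (Bar C C)) := by
  constructor
  · let g : Bar C C →+* C := Ring.DirectLimit.lift _ _ C
      (fun n : ℕ+ => ((coord (C := C) n : TPow C C n →ₐ[C] C) : TPow C C n →+* C))
      (fun i j hij x => coord_algHom _ x)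
    have h : ∀ c, g (algebraMap C (Bar C C) c) = c := fun c =>
      (Ring.DirectLimit.lift_of ..).trans
        ((coord (C := C) ((1 : ℕ+) : ℕ)).commutes c)
    exact Function.LeftInverse.injective h
  · intro z
    obtain ⟨n, x, rfl⟩ := Ring.DirectLimit.exists_of z
    exact ⟨coord n x, (Bar.of_eq_algebraMap n x).symm⟩

theorem tSeq_eq_algebraMap (c : C) : tSeq C c = algebraMap C (StdSeq C C) c := by
  funext n
  rw [tSeq, Bar.of_eq_algebraMap, coord, PiTensorProduct.constantBaseRingEquiv_tprod,
    Finset.prod_eq_single ⟨(n : ℕ) - 1, Nat.sub_lt n.pos one_pos⟩]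
  · rw [if_pos (Nat.sub_add_cancel (Nat.one_le_of_lt n.pos))]
    rfl
  · intro i _ hi
    rw [if_neg fun h => hi (Fin.ext (Nat.eq_sub_of_add_eq h))]
  · exact fun h => absurd (Finset.mem_univ _) h

/-! ### Binomial sequences -/

/-- The binomial transform `∑_{i ≤ p} binom(p, i) lam^i b_i`. -/
def binomSum (b : ℕ → C) (p : ℕ) : C :=
  ∑ i ∈ Finset.range (p + 1), (p.choose i : C) * lam ^ i * b i

theorem binomSeq_apply (b : ℕ → C) (n : ℕ+) :
    binomSeq lam b n = algebraMap C (Bar C C) (binomSum lam b ((n : ℕ) - 1)) := by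
  rw [binomSeq, binomSum, Nat.sub_add_cancel n.pos]

theorem binomSeq_succPNat (b : ℕ → C) (p : ℕ) :
    binomSeq lam b p.succPNat = algebraMap C (Bar C C) (binomSum lam b p) := by
  rw [binomSeq_apply]; simp

/-- Pascal's rule. The sequence `b'` is the shift of `b`, which is the effect of the Baxter operator
on coefficients. -/
theorem binomSum_shift_succ (b b' : ℕ → C) (h0 : b' 0 = 0) (h : ∀ i, b' (i + 1) = b i) (p : ℕ) :
    binomSum lam b' (p + 1) = binomSum lam b' p + lam * binomSum lam b p := by
  have h1 : binomSum lam b' p =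
      ∑ i ∈ Finset.range (p + 1), (p.choose (i + 1) : C) * lam ^ (i + 1) * b i := by
    -- The extra top term on the right vanishes because `p.choose (p + 1) = 0`; it is kept so that
    -- all three sums share one index range.
    rw [binomSum, Finset.sum_range_succ', h0, mul_zero, add_zero, Finset.sum_range_succ]
    simp [h]
  rw [h1, binomSum, binomSum, Finset.sum_range_succ', h0, mul_zero, add_zero, Finset.mul_sum,
    ← Finset.sum_add_distrib]
  refine Finset.sum_congr rfl fun i _ => ?_
  rw [h, Nat.choose_succ_succ', Nat.cast_add]
  ring

theorem stdOp_apply (x : StdSeq C C) (n : ℕ+) :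
    stdOp C lam x n = lam • ∑ i ∈ Finset.Iio n, x i := by
  simp [stdOp, LinearMap.sum_apply]

theorem stdOp_one (x : StdSeq C C) : stdOp C lam x 1 = 0 := by
  have : Finset.Iio (1 : ℕ+) = ∅ := by
    ext i; simp
  rw [stdOp_apply, this, Finset.sum_empty, smul_zero]

theorem stdOp_add_one (x : StdSeq C C) (n : ℕ+) :
    stdOp C lam x (n + 1) = stdOp C lam x n + lam • x n := by
  have : Finset.Iio (n + 1) = insert n (Finset.Iio n) := by
    ext i
    simp only [Finset.mem_Iio, Finset.mem_insert, PNat.lt_add_one_iff]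
    exact le_iff_eq_or_lt
  rw [stdOp_apply, stdOp_apply, this, Finset.sum_insert (by simp), smul_add, add_comm]

/-- Both sequences start at `0` and have the same successive differences. -/
theorem stdOp_binomSeq (b b' : ℕ → C) (h0 : b' 0 = 0) (h : ∀ i, b' (i + 1) = b i) :
    binomSeq lam b' = stdOp C lam (binomSeq lam b) := by
  funext n
  induction n using PNat.recOn with
  | one => rw [stdOp_one, binomSeq_apply]; simp [binomSum, h0]
  | succ n ih =>
    obtain ⟨p, rfl⟩ : ∃ p : ℕ, n = p.succPNat := ⟨n.natPred, (PNat.succPNat_natPred n).symm⟩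
    rw [stdOp_add_one, ← ih, binomSeq_succPNat, binomSeq_succPNat,
      show p.succPNat + 1 = (p + 1).succPNat from rfl, binomSeq_succPNat,
      binomSum_shift_succ lam b b' h0 h, map_add, map_mul, Algebra.smul_def]

/-- The map `b ↦ binomSeq lam b` is linear. -/
def binomLin : (ℕ → C) →ₗ[C] StdSeq C C where
  toFun := binomSeq lam
  map_add' b b' := by
    funext n
    simp only [binomSeq, Pi.add_apply, mul_add, Finset.sum_add_distrib, map_add]
  map_smul' c b := by
    funext n
    simp only [binomSeq, Pi.smul_apply, smul_eq_mul, mul_left_comm _ c, ← Finset.mul_sum, map_mul,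
      RingHom.id_apply, Algebra.smul_def]

theorem binomSeq_single (m : ℕ) :
    binomSeq lam (Pi.single m 1) =
      fun n : ℕ+ => algebraMap C (Bar C C) ((((n : ℕ) - 1).choose m : C) * lam ^ m) := by
  funext n
  rw [binomSeq_apply, binomSum]
  simp only [Pi.single_apply, mul_ite, mul_one, mul_zero, Finset.sum_ite_eq', Finset.mem_range]
  split_ifs with h
  · rfl
  · rw [Nat.choose_eq_zero_of_lt (by omega)]
    simp

/-- Other binomial coefficients may vanish in `C`, but the diagonal one is `1`, so the last term
`lam ^ p * b p` determines `b p` once the earlier entries vanish. -/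
theorem binomSeq_injective [IsDomain C] (hlam : lam ≠ 0) : Function.Injective (binomSeq lam) := by
  refine (injective_iff_map_eq_zero (binomLin lam)).2 fun b hb => ?_
  funext p
  induction p using Nat.strong_induction_on with
  | _ p ih =>
    have h := congr_fun hb p.succPNat
    change binomSeq lam b p.succPNat = 0 at h
    rw [binomSeq_succPNat, ← map_zero (algebraMap C (Bar C C))] at h
    have h := algebraMap_bar_bijective.1 h
    rw [binomSum, Finset.sum_range_succ, Finset.sum_eq_zero, zero_add, Nat.choose_self,
      Nat.cast_one, one_mul] at h
    · exact (mul_eq_zero.1 h).resolve_left (pow_ne_zero _ hlam)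
    · intro i hi
      rw [ih i (Finset.mem_range.1 hi), Pi.zero_apply, mul_zero]

/-! ### Coordinates -/

/-- The element `1^{⊗ (n+1)}`. -/
def shaOne (n : ℕ) : Sha lam C := Sha.incl lam C n 1

theorem incl_eq_smul_shaOne {n : ℕ} (a : TPow C C (n + 1)) :
    Sha.incl lam C n a = coord _ a • shaOne lam n := by
  conv_lhs => rw [eq_coord_smul a]
  rw [map_smul, shaOne]

variable {lam} in
theorem hom_ext_shaOne {N : Type*} [AddCommGroup N] [Module C N] {f g : Sha lam C →ₗ[C] N}
    (h : ∀ n, f (shaOne lam n) = g (shaOne lam n)) : f = g :=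
  Sha.hom_ext fun k a => by rw [incl_eq_smul_shaOne, map_smul, map_smul, h]

theorem shaOne_mul (m n : ℕ) :
    shaOne lam m * shaOne lam n =
      ∑ s : MixableShuffle m n, lam ^ s.merged.card • shaOne lam (m + n - s.merged.card) := by
  rw [shaOne, shaOne, Sha.mul_incl_incl, Sha.mulHom_apply]
  simp only [map_one, mul_one, shaOne]

theorem op_shaOne (n : ℕ) : Sha.op lam C (shaOne lam n) = shaOne lam (n + 1) := by
  rw [shaOne, Sha.op_incl, map_one, shaOne]

theorem j_eq_smul (c : C) : Sha.j lam C c = c • shaOne lam 0 := by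
  rw [Sha.j, LinearMap.comp_apply, incl_eq_smul_shaOne]
  congr 1
  simp [coord]

theorem one_eq_shaOne : (1 : Sha lam C) = shaOne lam 0 := by
  change Sha.j lam C 1 = _
  rw [j_eq_smul, one_smul]

theorem shaSum_eq_linearCombination (b : ℕ →₀ C) :
    shaSum lam b = Finsupp.linearCombination C (shaOne lam) b := rfl

theorem ofSha_shaSum (b : ℕ →₀ C) : ShaHat.ofSha lam C (shaSum lam b) = shaHatSum lam b := by
  funext k
  rw [shaSum_eq_linearCombination, Finsupp.linearCombination_apply, Finsupp.sum]
  change Sha.proj lam C k _ = b k • 1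
  rw [map_sum, Finset.sum_eq_single k]
  · rw [map_smul, shaOne, Sha.proj_incl_self]
  · intro i _ hi
    rw [map_smul, shaOne, Sha.proj_incl_of_ne lam C hi, smul_zero]
  · intro hk
    rw [Finsupp.notMem_support_iff.1 hk, zero_smul, map_zero]

theorem shaHatSum_bijective : Function.Bijective (shaHatSum lam) := by
  refine Function.bijective_iff_has_inverse.2 ⟨fun x n => coord _ (x n), fun b => ?_, fun x => ?_⟩
  · funext n
    simp [shaHatSum, tprod_one]
  · funext n
    exact (eq_coord_smul (x n)).symm

theorem shaSum_bijective : Function.Bijective (shaSum lam) := by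
  constructor
  · intro b b' h
    have := congr_arg (ShaHat.ofSha lam C) h
    rw [ofSha_shaSum, ofSha_shaSum] at this
    exact DFunLike.coe_injective ((shaHatSum_bijective lam).1 this)
  · change Function.Surjective (Finsupp.linearCombination C (shaOne lam))
    -- Surjectivity becomes the vanishing of the quotient map by the range, which can be checked on
    -- the basis.
    rw [← LinearMap.range_eq_top, ← Submodule.ker_mkQ (LinearMap.range _), LinearMap.ker_eq_top]
    refine hom_ext_shaOne fun n => ?_
    rw [LinearMap.zero_apply, Submodule.mkQ_apply, Submodule.Quotient.mk_eq_zero]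
    exact ⟨Finsupp.single n 1, by simp⟩

/-! ### The homomorphisms -/

/-- The linear map that sends `∑_n b_n 1^{⊗ (n+1)}` to `binomSeq lam b`. -/
def hatHom : ShaHat lam C →ₗ[C] StdSeq C C :=
  binomLin lam ∘ₗ (LinearMap.pi fun k => (coord (k + 1)).toLinearMap ∘ₗ
    (LinearMap.proj k : ((k : ℕ) → TPow C C (k + 1)) →ₗ[C] TPow C C (k + 1)))

theorem hatHom_apply (x : ShaHat lam C) :
    hatHom lam x = binomSeq lam fun k => coord (k + 1) (x k) := rfl

theorem hatHom_shaHatSum (b : ℕ → C) : hatHom lam (shaHatSum lam b) = binomSeq lam b := by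
  rw [hatHom_apply]
  congr 1
  funext k
  simp [shaHatSum, tprod_one]

theorem hatHom_injective [IsDomain C] (hlam : lam ≠ 0) : Function.Injective (hatHom lam) := by
  intro x y h
  obtain ⟨b, rfl⟩ := (shaHatSum_bijective lam).2 x
  obtain ⟨b', rfl⟩ := (shaHatSum_bijective lam).2 y
  rw [hatHom_shaHatSum, hatHom_shaHatSum] at h
  rw [binomSeq_injective lam hlam h]

theorem hatHom_congr {x y : ShaHat lam C} {n : ℕ+} (h : ∀ i < (n : ℕ), x i = y i) :
    hatHom lam x n = hatHom lam y n := by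
  rw [hatHom_apply, hatHom_apply, binomSeq, binomSeq]
  refine congr_arg _ (Finset.sum_congr rfl fun i hi => ?_)
  rw [h i (Finset.mem_range.1 hi)]

theorem hatHom_op (x : ShaHat lam C) :
    hatHom lam (ShaHat.op lam C x) = stdOp C lam (hatHom lam x) :=
  stdOp_binomSeq lam _ _ (map_zero (coord 1)) fun i =>
    coord_algHom (place Fin.succ) (x i)

theorem hatHom_shaOne (m : ℕ) :
    hatHom lam (ShaHat.ofSha lam C (shaOne lam m)) =
      fun n : ℕ+ => algebraMap C (Bar C C) ((((n : ℕ) - 1).choose m : C) * lam ^ m) := by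
  have h : shaOne lam m = shaSum lam (Finsupp.single m 1) := by
    rw [shaSum_eq_linearCombination]; simp
  rw [h, ofSha_shaSum, hatHom_shaHatSum, Finsupp.single_eq_pi_single, binomSeq_single]

theorem hatHom_ofSha_one : hatHom lam (ShaHat.ofSha lam C 1) = 1 := by
  rw [one_eq_shaOne, hatHom_shaOne]
  funext n
  simp

/-- By bilinearity this reduces to basis elements, where it is `MixableShuffle.sum_choose` at `N -
1`; the weights combine as $\lambda^{|T|}\lambda^{m+n-|T|}=\lambda^{m+n}$. -/
theorem hatHom_ofSha_mul (x y : Sha lam C) :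
    hatHom lam (ShaHat.ofSha lam C (x * y)) =
      hatHom lam (ShaHat.ofSha lam C x) * hatHom lam (ShaHat.ofSha lam C y) := by
  let f := hatHom lam ∘ₗ ShaHat.ofSha lam C
  have h : (Sha.mul lam C).compr₂ f = (LinearMap.mul C (StdSeq C C)).compl₁₂ f f := by
    refine hom_ext_shaOne fun m => hom_ext_shaOne fun n => ?_
    change f (shaOne lam m * shaOne lam n) = f (shaOne lam m) * f (shaOne lam n)
    rw [shaOne_mul, map_sum]
    simp only [map_smul, f, LinearMap.comp_apply, hatHom_shaOne]
    funext N
    rw [Finset.sum_apply, Pi.mul_apply, ← map_mul, mul_mul_mul_comm, ← Nat.cast_mul,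
      ← MixableShuffle.sum_choose, Nat.cast_sum, Finset.sum_mul, map_sum]
    refine Finset.sum_congr rfl fun s _ => ?_
    have := s.card_merged_le_left
    rw [Pi.smul_apply, Algebra.smul_def, ← map_mul, mul_left_comm, ← pow_add, ← pow_add,
      Nat.add_sub_cancel' (by omega)]
  exact LinearMap.congr_fun (LinearMap.congr_fun h x) y

theorem hatHom_mul (x y : ShaHat lam C) : hatHom lam (x * y) = hatHom lam x * hatHom lam y := by
  funext n
  have hx : ∀ z : ShaHat lam C,
      hatHom lam (ShaHat.ofSha lam C (ShaHat.trunc lam C n z)) n = hatHom lam z n := fun z =>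
    hatHom_congr lam fun i hi => ShaHat.ofSha_trunc lam C hi.le z
  rw [Pi.mul_apply, ← hx x, ← hx y, ← Pi.mul_apply, ← hatHom_ofSha_mul]
  exact hatHom_congr lam fun i hi => ShaHat.mul_apply lam C hi.le x y

theorem isBaxterHom_hatHom : IsBaxterHom (ShaHat.op lam C) (stdOp C lam) (hatHom lam) where
  map_one := hatHom_ofSha_one lam
  map_mul := hatHom_mul lam
  map_op := hatHom_op lam

theorem exists_eq_ofSha_add_op (x : ShaHat lam C) :
    ∃ (a : Sha lam C) (y : ShaHat lam C), x = ShaHat.ofSha lam C a + ShaHat.op lam C y := by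
  obtain ⟨b, rfl⟩ := (shaHatSum_bijective lam).2 x
  -- The constant term is split off; the rest is the operator applied to the shifted series.
  refine ⟨shaSum lam (Finsupp.single 0 (b 0)), shaHatSum lam fun i => b (i + 1), ?_⟩
  rw [ofSha_shaSum]
  funext k
  change b k • (1 : TPow C C (k + 1)) =
    Finsupp.single 0 (b 0) k • (1 : TPow C C (k + 1)) + ShaHat.op lam C _ k
  rcases k with _ | k
  · rw [ShaHat.op_apply_zero, Finsupp.single_eq_same, add_zero]
  · rw [ShaHat.op_apply_succ, Finsupp.single_eq_of_ne (by omega), zero_smul, zero_add, shaHatSum,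
      map_smul, tprod_one, map_one]

theorem eq_of_comp_ofSha_eq {f g : ShaHat lam C →ₗ[C] StdSeq C C}
    (hf : ∀ x, f (ShaHat.op lam C x) = stdOp C lam (f x))
    (hg : ∀ x, g (ShaHat.op lam C x) = stdOp C lam (g x))
    (h : ∀ x, f (ShaHat.ofSha lam C x) = g (ShaHat.ofSha lam C x)) : f = g := by
  refine LinearMap.ext fun x => funext fun n => ?_
  -- Component `n` of `stdOp` involves only components below `n`, but of the image of the new series
  -- `y`; hence `x` is generalized.
  induction n using PNat.strongInductionOn generalizing x with
  | _ n ih =>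
    obtain ⟨a, y, rfl⟩ := exists_eq_ofSha_add_op lam x
    rw [map_add, map_add, h, hf, hg, Pi.add_apply, Pi.add_apply, stdOp_apply, stdOp_apply,
      Finset.sum_congr rfl fun i hi => ih i (Finset.mem_Iio.1 hi) y]

theorem hatHom_ofSha_j (a : C) : hatHom lam (ShaHat.ofSha lam C (Sha.j lam C a)) = tSeq C a := by
  rw [j_eq_smul, map_smul, map_smul, ← one_eq_shaOne, hatHom_ofSha_one, tSeq_eq_algebraMap,
    Algebra.algebraMap_eq_smul_one]

/-- The image is spanned by the iterates $P'^n(1)$, which lie in every Baxter subalgebra. Conversely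
it is itself a Baxter subalgebra containing all $t^{(a)}$. -/
theorem range_hatHom_comp_ofSha :
    LinearMap.range (hatHom lam ∘ₗ ShaHat.ofSha lam C) = Subalgebra.toSubmodule (Std C lam) := by
  apply le_antisymm
  · rw [← Submodule.ker_mkQ (Subalgebra.toSubmodule (Std C lam)), LinearMap.range_le_ker_iff]
    refine hom_ext_shaOne fun n => ?_
    rw [LinearMap.zero_apply, LinearMap.comp_apply, Submodule.mkQ_apply,
      Submodule.Quotient.mk_eq_zero, LinearMap.comp_apply]
    induction n with
    | zero =>
      rw [← one_eq_shaOne, hatHom_ofSha_one]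
      exact one_mem (Std C lam)
    | succ n ih =>
      rw [← op_shaOne, ← ShaHat.op_ofSha, hatHom_op]
      exact stdOp_mem C lam _ ih
  · let S : Subalgebra C (StdSeq C C) :=
      (LinearMap.range (hatHom lam ∘ₗ ShaHat.ofSha lam C)).toSubalgebra
        ⟨1, hatHom_ofSha_one lam⟩
        (by
          rintro _ _ ⟨x, rfl⟩ ⟨y, rfl⟩
          exact ⟨x * y, hatHom_ofSha_mul lam x y⟩)
    have hS : Std C lam ≤ S := by
      refine sInf_le ⟨fun a => ⟨Sha.j lam C a, hatHom_ofSha_j lam a⟩, ?_⟩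
      rintro _ ⟨x, rfl⟩
      refine ⟨Sha.op lam C x, ?_⟩
      rw [LinearMap.comp_apply, ← ShaHat.op_ofSha, hatHom_op, LinearMap.comp_apply]
    exact hS

/-- The isomorphism `Ш_C(C) ≃ 𝔖(C)`. -/
def shaEquivStd [IsDomain C] (hlam : lam ≠ 0) : Sha lam C ≃ₗ[C] Std C lam :=
  (LinearEquiv.ofInjective (hatHom lam ∘ₗ ShaHat.ofSha lam C)
      ((hatHom_injective lam hlam).comp (ShaHat.ofSha_injective lam C))).trans
    (LinearEquiv.ofEq _ (Subalgebra.toSubmodule (Std C lam)) (range_hatHom_comp_ofSha lam))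

theorem coe_shaEquivStd [IsDomain C] (hlam : lam ≠ 0) (x : Sha lam C) :
    (shaEquivStd lam hlam x : StdSeq C C) = hatHom lam (ShaHat.ofSha lam C x) := rfl

theorem isBaxterHom_shaEquivStd [IsDomain C] (hlam : lam ≠ 0) :
    IsBaxterHom (Sha.op lam C) (Std.op C lam)
      (shaEquivStd lam hlam : Sha lam C →ₗ[C] Std C lam) where
  map_one := Subtype.ext (hatHom_ofSha_one lam)
  map_mul x y := Subtype.ext (hatHom_ofSha_mul lam x y)
  map_op x := Subtype.ext <|
    (congr_arg (hatHom lam) (ShaHat.op_ofSha lam C x).symm).trans (hatHom_op lam _)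

variable {lam} in
-- The basis consists of the iterates $P^n(1)$, so linearity, the unit and the operator fix all
-- values.
theorem baxterHom_ext {f g : Sha lam C →ₗ[C] Std C lam}
    (hf : IsBaxterHom (Sha.op lam C) (Std.op C lam) f)
    (hg : IsBaxterHom (Sha.op lam C) (Std.op C lam) g) : f = g := by
  refine hom_ext_shaOne fun n => ?_
  induction n with
  | zero => rw [← one_eq_shaOne, hf.map_one, hg.map_one]
  | succ n ih => rw [← op_shaOne, hf.map_op, hg.map_op, ih]

end Base

end FreeBaxter

end

theorem mainTheorem11 {C : Type*} [CommRing C] [IsDomain C] (lam : C) (hlam : lam ≠ 0) :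
    Function.Bijective (algebraMap C (FreeBaxter.Bar C C)) ∧
    Function.Bijective (FreeBaxter.shaSum lam) ∧
    Function.Bijective (FreeBaxter.shaHatSum lam) ∧
    ∃ Φ : FreeBaxter.Sha lam C ≃ₗ[C] FreeBaxter.Std C lam,
      -- `Φ` is the unique Baxter algebra homomorphism that sends each `a` to `t^{(a)}`
      (FreeBaxter.IsBaxterHom (FreeBaxter.Sha.op lam C) (FreeBaxter.Std.op C lam)
          (Φ : FreeBaxter.Sha lam C →ₗ[C] FreeBaxter.Std C lam) ∧
        ∀ a : C, (Φ (FreeBaxter.Sha.j lam C a) : FreeBaxter.StdSeq C C) =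
          FreeBaxter.tSeq C a) ∧
      (∀ Ψ : FreeBaxter.Sha lam C →ₗ[C] FreeBaxter.Std C lam,
        FreeBaxter.IsBaxterHom (FreeBaxter.Sha.op lam C) (FreeBaxter.Std.op C lam) Ψ →
        (∀ a : C, (Ψ (FreeBaxter.Sha.j lam C a) : FreeBaxter.StdSeq C C) =
          FreeBaxter.tSeq C a) →
        Ψ = Φ) ∧
      (∀ b : ℕ →₀ C, (Φ (FreeBaxter.shaSum lam b) : FreeBaxter.StdSeq C C) =
        FreeBaxter.binomSeq lam b) ∧
      ∃ Φhat : FreeBaxter.ShaHat lam C →ₗ[C] FreeBaxter.StdSeq C C,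
        -- `Φhat` is the unique Baxter algebra homomorphism extending `Φ`, and it is injective
        (FreeBaxter.IsBaxterHom (FreeBaxter.ShaHat.op lam C) (FreeBaxter.stdOp C lam) Φhat ∧
          (∀ x : FreeBaxter.Sha lam C, Φhat (FreeBaxter.ShaHat.ofSha lam C x) = Φ x) ∧
          Function.Injective Φhat) ∧
        (∀ Ψ : FreeBaxter.ShaHat lam C →ₗ[C] FreeBaxter.StdSeq C C,
          FreeBaxter.IsBaxterHom (FreeBaxter.ShaHat.op lam C) (FreeBaxter.stdOp C lam) Ψ →
          (∀ x : FreeBaxter.Sha lam C, Ψ (FreeBaxter.ShaHat.ofSha lam C x) = Φ x) →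
          Ψ = Φhat) ∧
        ∀ b : ℕ → C, Φhat (FreeBaxter.shaHatSum lam b) = FreeBaxter.binomSeq lam b := by
  refine ⟨FreeBaxter.algebraMap_bar_bijective, FreeBaxter.shaSum_bijective lam,
    FreeBaxter.shaHatSum_bijective lam, FreeBaxter.shaEquivStd lam hlam,
    ⟨FreeBaxter.isBaxterHom_shaEquivStd lam hlam, FreeBaxter.hatHom_ofSha_j lam⟩,
    fun Ψ hΨ _ => FreeBaxter.baxterHom_ext hΨ (FreeBaxter.isBaxterHom_shaEquivStd lam hlam),
    fun b => ?_, FreeBaxter.hatHom lam,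
    ⟨FreeBaxter.isBaxterHom_hatHom lam, fun _ => rfl, FreeBaxter.hatHom_injective lam hlam⟩,
    fun Ψ hΨ h => FreeBaxter.eq_of_comp_ofSha_eq lam hΨ.map_op (FreeBaxter.hatHom_op lam) h,
    FreeBaxter.hatHom_shaHatSum lam⟩
  rw [FreeBaxter.coe_shaEquivStd, FreeBaxter.ofSha_shaSum, FreeBaxter.hatHom_shaHatSum]
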